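/- **Theorem 7.4.** Let $\mathfrak g_{\mathbb R}$ be a finite-dimensional real simple Lie algebra with Killing form $\kappa_{\mathbb R}$, let $\theta$ be a Cartan involution of $\mathfrak g_{\mathbb R}$ (an involutive automorphism such that $-\kappa_{\mathbb R}(\cdot,\theta(\cdot))$ is positive definite), and suppose that $\mathfrak g_{\mathbb R}$ is split, i.e. that it has a Cartan subalgebra $\mathfrak h_{\mathbb R}$ on which $\theta$ acts by $-1$. Let $\mathfrak g$ and $\mathfrak h$ be the complexifications of $\mathfrak g_{\mathbb R}$ and $\mathfrak h_{\mathbb R}$, extend $\theta$ complex-linearly to $\mathfrak g$, and let $\mathfrak k=\mathfrak g^{\theta}$. Let $R\subset\mathfrak h^*$ be the set of roots of $(\mathfrak g,\mathfrak h)$ and $R_+\subset R$ a system of positive roots. Choose root vectors $E_\alpha\in\mathfrak g_{\mathbb R}\cap\mathfrak g_\alpha$ ($\alpha\in R$) with $\kappa_{\mathbb R}(E_\alpha,E_{-\alpha})=1$ and $\theta(E_\alpha)=-E_{-\alpha}$, and put $B_\alpha=E_{-\alpha}-E_\alpha\in\mathfrak k$. Let $X$ be a $\mathfrak k$-module over $\mathbb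 C$ (for example an integrable one, i.e. one that comes from a representation of a connected reductive group with Lie algebra $\mathfrak k$). Let $\mathfrak h^{\mathrm{reg}}=\{h\in\mathfrak h:\langle\alpha,h\rangle\neq 0\text{ for all }\alpha\in R_+\}$. For $\kappa\in\mathbb C$ with $\kappa\ne 0$, the boundary Casimir connection on the trivial bundle over $\mathfrak h^{\mathrm{reg}}$ with fibre $X$ is $$\nabla^{\mathrm{bCas}}=\kappa\,\mathrm d-\sum_{\alpha\in R_+}\frac{\mathrm d\alpha}{\alpha}\,B_\alpha^2 .$$ Then, for every $\kappa\neq 0$, this connection is flat: $\nabla=\kappa^{-1}\nabla^{\mathrm{bCas}}$ is a holomorphic connection with $[\nabla_\xi,\nabla_\eta]=\nabla_{[\xi,\eta]}$ for all holomorphic vector fields $\xi,\eta$ on open subsets of $\mathfrak h^{\mathrm{reg}}$, and, in any linear coordinates $z_1,\dots,z_n$ on $\mathfrak h$, $[\nabla^{\mathrm{bCas}}_{\partial/\partial z_i},\nabla^{\mathrm{bCas}}_{\partial/\partial z_j}]=0$ for all $1\le i,j\le n$. Here a holomorphic section of the trivial bundle is a function with values in $X$ which is locally a finite sum $\sum_i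 f_i x_i$ with $f_i$ holomorphic functions and $x_i\in X$. -/

import Mathlib

open scoped TensorProduct

noncomputable section

namespace SplitPair

/-! ### Split symmetric pairs

`L` is a finite-dimensional real Lie algebra, `ℂ ⊗[ℝ] L` its complexification. -/

section LieTheory

variable {L : Type*} [LieRing L] [LieAlgebra ℝ L]

/-- `θ` is a Cartan involution: an involutive automorphism such that the symmetric bilinear form
`-κ(x, θ y)` is positive definite, where `κ` is the Killing form. -/
structure IsCartanInvolution (θ : L ≃ₗ⁅ℝ⁆ L) : Prop where
  involutive : ∀ x, θ (θ x) = x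
  pos : ∀ x, x ≠ 0 → 0 < -(killingForm ℝ L x (θ x))

/-- The complexification of an automorphism `θ` of the real Lie algebra `L`. -/
def thetaC (θ : L ≃ₗ⁅ℝ⁆ L) : (ℂ ⊗[ℝ] L) →ₗ[ℂ] (ℂ ⊗[ℝ] L) :=
  LinearMap.baseChange ℂ ((θ : L →ₗ⁅ℝ⁆ L) : L →ₗ[ℝ] L)

theorem thetaC_tmul (θ : L ≃ₗ⁅ℝ⁆ L) (a : ℂ) (x : L) :
    thetaC θ (a ⊗ₜ[ℝ] x) = a ⊗ₜ[ℝ] θ x := rfl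

theorem thetaC_lie (θ : L ≃ₗ⁅ℝ⁆ L) (x y : ℂ ⊗[ℝ] L) :
    thetaC θ ⁅x, y⁆ = ⁅thetaC θ x, thetaC θ y⁆ :=
  LieHom.map_lie (LieAlgebra.ExtendScalars.map (AlgHom.id ℝ ℂ) (θ : L →ₗ⁅ℝ⁆ L)) x y

/-- The complex Lie algebra `𝔨`: the fixed points of `θ` in the complexification of `L`. -/
def fixedPoints (θ : L ≃ₗ⁅ℝ⁆ L) : LieSubalgebra ℂ (ℂ ⊗[ℝ] L) where
  carrier := {x | thetaC θ x = x}
  add_mem' {x y} hx hy := by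
    simp only [Set.mem_ofPred_eq] at hx hy ⊢
    rw [map_add, hx, hy]
  zero_mem' := by simp
  smul_mem' c x hx := by
    simp only [Set.mem_ofPred_eq] at hx ⊢
    rw [map_smul, hx]
  lie_mem' {x y} hx hy := by
    change thetaC θ x = x at hx
    change thetaC θ y = y at hy
    change thetaC θ ⁅x, y⁆ = ⁅x, y⁆
    rw [thetaC_lie, hx, hy]

/-- The complexification `𝔥` of a real subalgebra `H`, as a subspace of the complexification
of `L`. -/
abbrev cartanC (H : LieSubalgebra ℝ L) : Submodule ℂ (ℂ ⊗[ℝ] L) :=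
  H.toSubmodule.baseChange ℂ

/-- `x` lies in the simultaneous eigenspace of `𝔥` (acting by the adjoint action) with
eigenvalue `α ∈ 𝔥*`. -/
def MemRootSpace (H : LieSubalgebra ℝ L) (α : Module.Dual ℂ (cartanC H)) (x : ℂ ⊗[ℝ] L) : Prop :=
  ∀ h : cartanC H, ⁅(h : ℂ ⊗[ℝ] L), x⁆ = α h • x

/-- The roots of the complexification of `L` with respect to `𝔥`. -/
def IsRoot (H : LieSubalgebra ℝ L) (α : Module.Dual ℂ (cartanC H)) : Prop :=
  α ≠ 0 ∧ ∃ x, x ≠ 0 ∧ MemRootSpace H α x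

/-- `P` is a system of positive roots: it consists of roots, contains exactly one of `α`, `-α` for
each root `α`, and contains every root which is a sum of two of its elements. -/
structure IsPositiveSystem (H : LieSubalgebra ℝ L)
    (P : Finset (Module.Dual ℂ (cartanC H))) : Prop where
  isRoot : ∀ α ∈ P, IsRoot H α
  exactly_one : ∀ α, IsRoot H α → Xor (α ∈ P) (-α ∈ P)
  add_mem : ∀ α ∈ P, ∀ β ∈ P, IsRoot H (α + β) → α + β ∈ P

/-- A choice of root vectors `E_α`, one for every root `α`, in the real form `L`, such that
`κ(E_α, E_{-α}) = 1` and `θ(E_α) = -E_{-α}`. Values of `E` off the roots are irrelevant. -/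
structure IsRootVectorSystem (θ : L ≃ₗ⁅ℝ⁆ L) (H : LieSubalgebra ℝ L)
    (E : Module.Dual ℂ (cartanC H) → L) : Prop where
  mem_rootSpace : ∀ α, IsRoot H α → MemRootSpace H α ((1 : ℂ) ⊗ₜ[ℝ] E α)
  killing_eq_one : ∀ α, IsRoot H α → killingForm ℝ L (E α) (E (-α)) = 1
  theta_eq : ∀ α, IsRoot H α → θ (E α) = -E (-α)

/-- The element `B_α = F_α + θ(F_α) = F_α - E_α` of `𝔨`, where `F_α = E_{-α}`. -/
def boundaryGen {θ : L ≃ₗ⁅ℝ⁆ L} (hθ : IsCartanInvolution θ) {H : LieSubalgebra ℝ L}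
    (E : Module.Dual ℂ (cartanC H) → L) (α : Module.Dual ℂ (cartanC H)) : fixedPoints θ :=
  ⟨(1 : ℂ) ⊗ₜ[ℝ] (E (-α) + θ (E (-α))), by
    change thetaC θ _ = _
    rw [thetaC_tmul, map_add, hθ.involutive, add_comm]⟩

end LieTheory

/-! ### Connections on trivial bundles

`V` is the coordinate space, `M ⊆ V` the base, `X` the fibre: a complex vector space of arbitrary
dimension. A section of the trivial bundle over an open set `U` is a function `V → X` of which
only the values on `U` matter, and likewise for vector fields. -/

section Connections

variable {V : Type*} [NormedAddCommGroup V] [NormedSpace ℂ V]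
variable {X : Type*} [AddCommGroup X] [Module ℂ X]

/-- Holomorphic sections over `U` of the trivial bundle with fibre `X`: locally, finite sums
`∑ fᵢ xᵢ` with `fᵢ` holomorphic functions and `xᵢ ∈ X`. For finite-dimensional `X` these are
the usual holomorphic maps `U → X`. -/
def HolSection (U : Set V) (s : V → X) : Prop :=
  ∀ p ∈ U, ∃ W : Set V, IsOpen W ∧ p ∈ W ∧ W ⊆ U ∧
    ∃ (m : ℕ) (f : Fin m → V → ℂ) (x : Fin m → X),
      (∀ i, AnalyticOnNhd ℂ (f i) W) ∧ ∀ q ∈ W, s q = ∑ i, f i q • x i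

/-- `y` is the derivative of `s` at `p` in the direction `v`, tested against linear functionals
(which separate the points of `X`, so `y` is unique). -/
def HasDirDerivAt (s : V → X) (v p : V) (y : X) : Prop :=
  ∀ φ : Module.Dual ℂ X, HasDerivAt (fun t : ℂ => φ (s (p + t • v))) (φ y) 0

open Classical in
/-- The derivative of `s` at `p` in the direction `v` (zero if there is none; it always exists
for holomorphic sections). -/
def dirDeriv (s : V → X) (v p : V) : X :=
  if h : ∃ y, HasDirDerivAt s v p y then h.choose else 0

/-- `D ξ s` stands for `∇_ξ s`, for local holomorphic vector fields `ξ` and local holomorphic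
sections `s`. `IsConnection M D` says that `D` is a holomorphic connection on the trivial bundle
with fibre `X` over the open set `M`: it is local, sends holomorphic sections to holomorphic
sections, is additive in `s`, linear over functions in `ξ`, and satisfies the Leibniz rule. -/
structure IsConnection (M : Set V) (D : (V → V) → (V → X) → (V → X)) : Prop where
  isOpen_base : IsOpen M
  congr : ∀ U : Set V, IsOpen U → U ⊆ M → ∀ (ξ η : V → V) (s t : V → X),
    Set.EqOn ξ η U → Set.EqOn s t U → Set.EqOn (D ξ s) (D η t) U
  holSection : ∀ U : Set V, IsOpen U → U ⊆ M → ∀ (ξ : V → V) (s : V → X),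
    AnalyticOnNhd ℂ ξ U → HolSection U s → HolSection U (D ξ s)
  add : ∀ U : Set V, IsOpen U → U ⊆ M → ∀ (ξ : V → V) (s t : V → X),
    AnalyticOnNhd ℂ ξ U → HolSection U s → HolSection U t →
    Set.EqOn (D ξ (s + t)) (D ξ s + D ξ t) U
  linear_field : ∀ U : Set V, IsOpen U → U ⊆ M → ∀ (f g : V → ℂ) (ξ η : V → V) (s : V → X),
    AnalyticOnNhd ℂ f U → AnalyticOnNhd ℂ g U → AnalyticOnNhd ℂ ξ U → AnalyticOnNhd ℂ η U →
    HolSection U s →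
    Set.EqOn (D (fun p => f p • ξ p + g p • η p) s)
      (fun p => f p • D ξ s p + g p • D η s p) U
  leibniz : ∀ U : Set V, IsOpen U → U ⊆ M → ∀ (f : V → ℂ) (ξ : V → V) (s : V → X),
    AnalyticOnNhd ℂ f U → AnalyticOnNhd ℂ ξ U → HolSection U s →
    Set.EqOn (D ξ (fun p => f p • s p))
      (fun p => fderiv ℂ f p (ξ p) • s p + f p • D ξ s p) U

/-- A flat connection: `∇_ξ ∇_η - ∇_η ∇_ξ = ∇_{[ξ, η]}` for all local holomorphic vector
fields. -/
structure IsFlatConnection (M : Set V) (D : (V → V) → (V → X) → (V → X)) : Prop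
    extends IsConnection M D where
  flat : ∀ U : Set V, IsOpen U → U ⊆ M → ∀ (ξ η : V → V) (s : V → X),
    AnalyticOnNhd ℂ ξ U → AnalyticOnNhd ℂ η U → HolSection U s →
    Set.EqOn (D ξ (D η s) - D η (D ξ s)) (D (VectorField.lieBracket ℂ ξ η) s) U

end Connections

/-! ### The boundary Casimir connection -/

section BoundaryCasimir

variable {L : Type*} [LieRing L] [LieAlgebra ℝ L]

/-- The complement `𝔥^reg` of the root hyperplanes, in the linear coordinates `z` on `𝔥`. -/
def hReg {H : LieSubalgebra ℝ L} {n : ℕ} (z : cartanC H ≃ₗ[ℂ] (Fin n → ℂ))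
    (P : Finset (Module.Dual ℂ (cartanC H))) : Set (Fin n → ℂ) :=
  {p | ∀ α ∈ P, α (z.symm p) ≠ 0}

variable {X : Type*} [AddCommGroup X] [Module ℂ X]

/-- The operators `∇_ξ` for `∇ = κ d - ∑_{α > 0} (dα/α) B_α²`, in the linear coordinates `z`
on `𝔥`, acting on functions with values in the `𝔨`-module `X`. -/
def boundaryCasimir {θ : L ≃ₗ⁅ℝ⁆ L} (hθ : IsCartanInvolution θ) {H : LieSubalgebra ℝ L}
    (E : Module.Dual ℂ (cartanC H) → L) (P : Finset (Module.Dual ℂ (cartanC H)))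
    {n : ℕ} (z : cartanC H ≃ₗ[ℂ] (Fin n → ℂ)) [LieRingModule (fixedPoints θ) X] (κ : ℂ)
    (ξ : (Fin n → ℂ) → (Fin n → ℂ)) (s : (Fin n → ℂ) → X) (p : Fin n → ℂ) : X :=
  κ • dirDeriv s (ξ p) p -
    ∑ α ∈ P, (α (z.symm (ξ p)) / α (z.symm p)) •
      ⁅boundaryGen hθ E α, ⁅boundaryGen hθ E α, s p⁆⁆

end BoundaryCasimir

end SplitPair

end

/-!
The connection is `∇ = d - A` with `A = κ⁻¹ ∑ (dα/α) B_α²`. The form `A` is closed, being a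
combination of logarithmic differentials with constant coefficients, so flatness amounts to
`A ∧ A = 0`, i.e. to the commutation of `A(u)` and `A(v)` at each point of `𝔥^reg`
(`isFlatConnection_logConnection`).

The commutator of `A(u)` and `A(v)` is the sum over pairs of positive roots of
`(α ∧ β)(u, v) / (α β) · B_α² B_β²`, up to a factor. Grouping the pairs according to the plane they
span reduces its vanishing to Kohno's condition (`commute_sum_div_smul`): for every plane `W` in
`𝔥*`, the sum of the `B_β²` with `β ∈ W` commutes with each of its terms.

This sum is a Casimir operator. By one-dimensionality of root spaces, `[E_γ, E_δ]` is a multiple of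
`E_{γ+δ}`, and applying `θ` shows that the `B_β` with `β ∈ W` span a Lie subalgebra
(`lie_boundaryVec_mem_span`). They are orthogonal, all of square length `-2`, for the invariant
Killing form (`killingForm_boundaryVec`), so that the structure constants are antisymmetric and
`∑ B_β²` commutes with each `B_γ` (`commute_sum_boundaryGen_sq`).

One-dimensionality of root spaces is Mathlib's theorem for split Cartan subalgebras of Killing Lie
algebras, applied to the real form itself: `ad h` is symmetric for the inner product `-κ(x, θ y)`,
hence diagonalizable over `ℝ` (`IsCartanInvolution.isTriangularizable`).
-/

open scoped TensorProduct

namespace SplitPair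

/-! ### Directional derivatives of sections -/

section Derivatives

open Filter Topology

variable {V : Type*} [NormedAddCommGroup V] [NormedSpace ℂ V]
variable {X : Type*} [AddCommGroup X] [Module ℂ X]
variable {s t : V → X} {v p : V} {x y : X} {U : Set V}

theorem HasDirDerivAt.unique (hx : HasDirDerivAt s v p x) (hy : HasDirDerivAt s v p y) :
    x = y := by
  rw [← sub_eq_zero]
  refine (Module.forall_dual_apply_eq_zero_iff ℂ (x - y)).1 fun φ => ?_
  rw [map_sub, sub_eq_zero]
  exact (hx φ).unique (hy φ)

theorem HasDirDerivAt.dirDeriv_eq (h : HasDirDerivAt s v p y) : dirDeriv s v p = y := by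
  have hex : ∃ y, HasDirDerivAt s v p y := ⟨y, h⟩
  rw [dirDeriv, dif_pos hex]
  exact hex.choose_spec.unique h

theorem tendsto_add_smul_zero (v p : V) : Tendsto (fun t : ℂ => p + t • v) (𝓝 0) (𝓝 p) := by
  have : Continuous fun t : ℂ => p + t • v := by fun_prop
  simpa using this.tendsto 0

theorem hasDirDerivAt_congr (h : s =ᶠ[𝓝 p] t) : HasDirDerivAt s v p y ↔ HasDirDerivAt t v p y := by
  refine forall_congr' fun φ => Filter.EventuallyEq.hasDerivAt_iff ?_
  filter_upwards [(tendsto_add_smul_zero v p).eventually h] with r hr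
  rw [hr]

theorem dirDeriv_congr (h : s =ᶠ[𝓝 p] t) : dirDeriv s v p = dirDeriv t v p := by
  by_cases hs : ∃ y, HasDirDerivAt s v p y
  · obtain ⟨y, hy⟩ := hs
    rw [hy.dirDeriv_eq, ((hasDirDerivAt_congr h).1 hy).dirDeriv_eq]
  · have ht : ¬ ∃ y, HasDirDerivAt t v p y := by simpa only [hasDirDerivAt_congr h] using hs
    rw [dirDeriv, dirDeriv, dif_neg hs, dif_neg ht]

theorem HasDirDerivAt.add (hs : HasDirDerivAt s v p x) (ht : HasDirDerivAt t v p y) :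
    HasDirDerivAt (fun q => s q + t q) v p (x + y) := fun φ => by
  simpa only [map_add] using (hs φ).fun_add (ht φ)

theorem HasDirDerivAt.sub (hs : HasDirDerivAt s v p x) (ht : HasDirDerivAt t v p y) :
    HasDirDerivAt (fun q => s q - t q) v p (x - y) := fun φ => by
  simpa only [map_sub] using (hs φ).fun_sub (ht φ)

theorem HasDirDerivAt.sum {ι : Type*} {P : Finset ι} {s : ι → V → X} {y : ι → X}
    (h : ∀ i ∈ P, HasDirDerivAt (s i) v p (y i)) :
    HasDirDerivAt (fun q => ∑ i ∈ P, s i q) v p (∑ i ∈ P, y i) := fun φ => by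
  simpa only [map_sum] using HasDerivAt.fun_sum fun i hi => h i hi φ

theorem HasDirDerivAt.map (T : X →ₗ[ℂ] X) (h : HasDirDerivAt s v p y) :
    HasDirDerivAt (fun q => T (s q)) v p (T y) := fun φ => h (φ ∘ₗ T)

theorem hasDirDerivAt_const (x : X) : HasDirDerivAt (fun _ => x) v p 0 := fun φ => by
  simpa using hasDerivAt_const (0 : ℂ) (φ x)

theorem hasDerivAt_comp_add_smul {f : V → ℂ} (hf : DifferentiableAt ℂ f p) :
    HasDerivAt (fun r : ℂ => f (p + r • v)) (fderiv ℂ f p v) 0 := by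
  have h := hf.hasFDerivAt.hasLineDerivAt v
  exact h

theorem HasDirDerivAt.smul {f : V → ℂ} (hf : DifferentiableAt ℂ f p)
    (h : HasDirDerivAt s v p y) :
    HasDirDerivAt (fun q => f q • s q) v p (fderiv ℂ f p v • s p + f p • y) := fun φ => by
  simpa using (hasDerivAt_comp_add_smul hf (v := v)).fun_mul (h φ)

/-! ### Holomorphic sections -/

/-- The local representations of a holomorphic section may be indexed by arbitrary finite sets. -/
theorem holSection_iff : HolSection U s ↔ ∀ p ∈ U, ∃ W : Set V, IsOpen W ∧ p ∈ W ∧ W ⊆ U ∧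
    ∃ (ι : Type) (P : Finset ι) (f : ι → V → ℂ) (x : ι → X),
      (∀ i ∈ P, AnalyticOnNhd ℂ (f i) W) ∧ ∀ q ∈ W, s q = ∑ i ∈ P, f i q • x i := by
  refine forall₂_congr fun p _ => exists_congr fun W => and_congr_right fun _ =>
    and_congr_right fun _ => and_congr_right fun _ => ⟨?_, ?_⟩
  · rintro ⟨m, f, x, hf, hs⟩
    exact ⟨Fin m, Finset.univ, f, x, fun i _ => hf i, hs⟩
  · rintro ⟨ι, P, f, x, hf, hs⟩
    refine ⟨P.card, fun i => f (P.equivFin.symm i), fun i => x (P.equivFin.symm i),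
      fun i => hf _ (P.equivFin.symm i).2, fun q hq => ?_⟩
    rw [hs q hq, ← Finset.sum_coe_sort,
      ← Equiv.sum_comp P.equivFin.symm fun i : P => f i q • x i]

theorem holSection_zero (hU : IsOpen U) : HolSection U (fun _ => (0 : X)) := fun _ hp =>
  ⟨U, hU, hp, le_rfl, 0, Fin.elim0, Fin.elim0, fun i => i.elim0, by simp⟩

theorem HolSection.add (hs : HolSection U s) (ht : HolSection U t) :
    HolSection U (fun q => s q + t q) := holSection_iff.2 fun p hp => by
  obtain ⟨W, hW, hpW, hWU, m, f, x, hf, h⟩ := hs p hp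
  obtain ⟨W', hW', hpW', hWU', m', f', x', hf', h'⟩ := ht p hp
  refine ⟨W ∩ W', hW.inter hW', ⟨hpW, hpW'⟩, fun q hq => hWU hq.1, Fin m ⊕ Fin m', Finset.univ,
    Sum.elim f f', Sum.elim x x', ?_, fun q hq => ?_⟩
  · rintro (i | i) -
    · exact (hf i).mono Set.inter_subset_left
    · exact (hf' i).mono Set.inter_subset_right
  · simp [h q hq.1, h' q hq.2]

theorem HolSection.smul {f : V → ℂ} (hf : AnalyticOnNhd ℂ f U) (hs : HolSection U s) :
    HolSection U (fun q => f q • s q) := fun p hp => by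
  obtain ⟨W, hW, hpW, hWU, m, g, x, hg, h⟩ := hs p hp
  refine ⟨W, hW, hpW, hWU, m, fun i q => f q * g i q, x, fun i => (hf.mono hWU).mul (hg i),
    fun q hq => ?_⟩
  simp only [h q hq, Finset.smul_sum, mul_smul]

theorem HolSection.map (T : X →ₗ[ℂ] X) (hs : HolSection U s) :
    HolSection U (fun q => T (s q)) := fun p hp => by
  obtain ⟨W, hW, hpW, hWU, m, g, x, hg, h⟩ := hs p hp
  refine ⟨W, hW, hpW, hWU, m, g, fun i => T (x i), hg, fun q hq => ?_⟩
  simp only [h q hq, map_sum, map_smul]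

theorem HolSection.sum {ι : Type*} {P : Finset ι} {s : ι → V → X} (hU : IsOpen U)
    (hs : ∀ i ∈ P, HolSection U (s i)) : HolSection U (fun q => ∑ i ∈ P, s i q) := by
  classical
  induction P using Finset.induction_on with
  | empty => simpa using holSection_zero hU
  | insert i P hi ih =>
    simp only [Finset.sum_insert hi]
    exact (hs i (Finset.mem_insert_self i P)).add
      (ih fun j hj => hs j (Finset.mem_insert_of_mem hj))

theorem HolSection.sub (hs : HolSection U s) (ht : HolSection U t) :
    HolSection U (fun q => s q - t q) := by
  simpa [sub_eq_add_neg] using hs.add (ht.map (-LinearMap.id))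

theorem hasDirDerivAt_of_eq_sum {m : ℕ} {f : Fin m → V → ℂ} {x : Fin m → X} (hU : IsOpen U)
    (hp : p ∈ U) (hf : ∀ i, AnalyticOnNhd ℂ (f i) U) (hs : ∀ q ∈ U, s q = ∑ i, f i q • x i)
    (v : V) : HasDirDerivAt s v p (∑ i, fderiv ℂ (f i) p v • x i) := by
  rw [hasDirDerivAt_congr (Filter.eventually_of_mem (hU.mem_nhds hp) hs)]
  refine HasDirDerivAt.sum fun i _ => ?_
  simpa using (hasDirDerivAt_const (v := v) (p := p) (x i)).smul (hf i p hp).differentiableAt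

theorem HolSection.hasDirDerivAt (hs : HolSection U s) (hp : p ∈ U) (v : V) :
    HasDirDerivAt s v p (dirDeriv s v p) := by
  obtain ⟨W, hW, hpW, -, m, f, x, hf, h⟩ := hs p hp
  have := hasDirDerivAt_of_eq_sum hW hpW hf h v
  rwa [this.dirDeriv_eq]

theorem HolSection.dirDeriv_add_smul (hs : HolSection U s) (hp : p ∈ U) (a b : ℂ) (v w : V) :
    dirDeriv s (a • v + b • w) p = a • dirDeriv s v p + b • dirDeriv s w p := by
  obtain ⟨W, hW, hpW, -, m, f, x, hf, h⟩ := hs p hp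
  simp only [(hasDirDerivAt_of_eq_sum hW hpW hf h _).dirDeriv_eq, Finset.smul_sum, ← mul_smul,
    ← add_smul, ← Finset.sum_add_distrib, map_add, map_smul, smul_eq_mul]

theorem analyticOnNhd_fderiv_apply {f : V → ℂ} {ξ : V → V} (hf : AnalyticOnNhd ℂ f U)
    (hξ : AnalyticOnNhd ℂ ξ U) : AnalyticOnNhd ℂ (fun q => fderiv ℂ f q (ξ q)) U := fun q hq =>
  AnalyticAt.comp₂ (h := fun x : (V →L[ℂ] ℂ) × V => x.1 x.2)
    ((ContinuousLinearMap.id ℂ (V →L[ℂ] ℂ)).analyticAt_bilinear _) (hf q hq).fderiv (hξ q hq)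

theorem HolSection.dirDeriv {ξ : V → V} (hs : HolSection U s) (hξ : AnalyticOnNhd ℂ ξ U) :
    HolSection U (fun q => dirDeriv s (ξ q) q) := fun p hp => by
  obtain ⟨W, hW, hpW, hWU, m, f, x, hf, h⟩ := hs p hp
  exact ⟨W, hW, hpW, hWU, m, _, x, fun i => analyticOnNhd_fderiv_apply (hf i) (hξ.mono hWU),
    fun q hq => (hasDirDerivAt_of_eq_sum hW hq hf h _).dirDeriv_eq⟩

/-- `ξ(η f) - η(ξ f) = [ξ, η] f` for functions. -/
theorem fderiv_fderiv_apply_sub {f : V → ℂ} {ξ η : V → V} (hf : AnalyticAt ℂ f p)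
    (hξ : AnalyticAt ℂ ξ p) (hη : AnalyticAt ℂ η p) :
    fderiv ℂ (fun q => fderiv ℂ f q (η q)) p (ξ p) -
        fderiv ℂ (fun q => fderiv ℂ f q (ξ q)) p (η p) =
      fderiv ℂ f p (VectorField.lieBracket ℂ ξ η p) := by
  have hf' := hf.fderiv.differentiableAt
  have hsymm : IsSymmSndFDerivAt ℂ f p :=
    (hf.contDiffAt (n := 2)).isSymmSndFDerivAt (by simp)
  rw [fderiv_clm_apply hf' hξ.differentiableAt, fderiv_clm_apply hf' hη.differentiableAt]
  simp [VectorField.lieBracket, hsymm.eq (ξ p) (η p)]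

/-- `ξ(η s) - η(ξ s) = [ξ, η] s` for sections. -/
theorem HolSection.dirDeriv_dirDeriv_sub {ξ η : V → V} (hs : HolSection U s) (hp : p ∈ U)
    (hξ : AnalyticOnNhd ℂ ξ U) (hη : AnalyticOnNhd ℂ η U) :
    SplitPair.dirDeriv (fun q => SplitPair.dirDeriv s (η q) q) (ξ p) p -
      SplitPair.dirDeriv (fun q => SplitPair.dirDeriv s (ξ q) q) (η p) p =
      SplitPair.dirDeriv s (VectorField.lieBracket ℂ ξ η p) p := by
  obtain ⟨W, hW, hpW, hWU, m, f, x, hf, h⟩ := hs p hp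
  have key : ∀ (ζ : V → V), AnalyticOnNhd ℂ ζ U → ∀ v,
      SplitPair.dirDeriv (fun q => SplitPair.dirDeriv s (ζ q) q) v p =
        ∑ i, fderiv ℂ (fun q => fderiv ℂ (f i) q (ζ q)) p v • x i := fun ζ hζ v =>
    (hasDirDerivAt_of_eq_sum hW hpW (fun i => analyticOnNhd_fderiv_apply (hf i) (hζ.mono hWU))
      (fun q hq => (hasDirDerivAt_of_eq_sum hW hq hf h _).dirDeriv_eq) v).dirDeriv_eq
  rw [key η hη, key ξ hξ, (hasDirDerivAt_of_eq_sum hW hpW hf h _).dirDeriv_eq,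
    ← Finset.sum_sub_distrib]
  refine Finset.sum_congr rfl fun i _ => ?_
  rw [← sub_smul, fderiv_fderiv_apply_sub (hf i p hpW) (hξ p hp) (hη p hp)]

end Derivatives

/-! ### Connections with logarithmic poles along hyperplanes -/

section LogConnection

open Filter Topology

variable {V : Type*} [NormedAddCommGroup V] [NormedSpace ℂ V]
variable {X : Type*} [AddCommGroup X] [Module ℂ X] {ι : Type*}

/-- The contraction at `p` with the vector `v` of the form `∑ (daᵢ/aᵢ) Tᵢ`. -/
noncomputable def logForm (P : Finset ι) (a : ι → V →L[ℂ] ℂ) (T : ι → Module.End ℂ X) (p v : V) :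
    Module.End ℂ X :=
  ∑ i ∈ P, (a i v / a i p) • T i

/-- The connection `d - ∑ (daᵢ/aᵢ) Tᵢ`. -/
noncomputable def logConnection (P : Finset ι) (a : ι → V →L[ℂ] ℂ) (T : ι → Module.End ℂ X)
    (ξ : V → V) (s : V → X) (p : V) : X :=
  dirDeriv s (ξ p) p - logForm P a T p (ξ p) (s p)

variable {P : Finset ι} {a : ι → V →L[ℂ] ℂ} {T : ι → Module.End ℂ X} {U : Set V} {p v w : V}
variable {ξ η : V → V} {s : V → X}

theorem logForm_add_smul (b c : ℂ) :
    logForm P a T p (b • v + c • w) = b • logForm P a T p v + c • logForm P a T p w := by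
  simp only [logForm, Finset.smul_sum, smul_smul, ← Finset.sum_add_distrib, ← add_smul, map_add,
    map_smul, smul_eq_mul, add_div, mul_div_assoc]

theorem logForm_sub : logForm P a T p (v - w) = logForm P a T p v - logForm P a T p w := by
  simpa [sub_eq_add_neg] using logForm_add_smul (P := P) (a := a) (T := T) (p := p) (v := v)
    (w := w) 1 (-1)

theorem isOpen_hyperplaneComplement : IsOpen {p : V | ∀ i ∈ P, a i p ≠ 0} := by
  have : {p : V | ∀ i ∈ P, a i p ≠ 0} = ⋂ i ∈ P, {p : V | a i p ≠ 0} := by ext; simp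
  rw [this]
  exact isOpen_biInter_finset fun i _ => isOpen_ne_fun (a i).continuous continuous_const

theorem analyticOnNhd_div (hU : ∀ p ∈ U, ∀ i ∈ P, a i p ≠ 0) (hξ : AnalyticOnNhd ℂ ξ U)
    {i : ι} (hi : i ∈ P) : AnalyticOnNhd ℂ (fun q => a i (ξ q) / a i q) U := fun q hq =>
  ((a i).analyticAt _ |>.comp (hξ q hq)).div ((a i).analyticAt q) (hU q hq i hi)

theorem HolSection.logForm (hUo : IsOpen U) (hU : ∀ p ∈ U, ∀ i ∈ P, a i p ≠ 0)
    (hξ : AnalyticOnNhd ℂ ξ U) (hs : HolSection U s) :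
    HolSection U (fun q => logForm P a T q (ξ q) (s q)) := by
  simp only [SplitPair.logForm, LinearMap.sum_apply, LinearMap.smul_apply]
  exact HolSection.sum hUo fun i hi => (hs.map (T i)).smul (analyticOnNhd_div hU hξ hi)

/-- The derivative of the contraction of `db/b` with a vector field `η`. The second term is
symmetric in `v` and `η p`, which expresses that `db/b` is closed. -/
theorem fderiv_div_apply (b : V →L[ℂ] ℂ) (hp : b p ≠ 0) (hη : DifferentiableAt ℂ η p) :
    fderiv ℂ (fun q => b (η q) / b q) p v =
      b (fderiv ℂ η p v) / b p - b v * b (η p) / (b p * b p) := by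
  have h1 : DifferentiableAt ℂ (fun q => b (η q)) p := b.differentiableAt.comp p hη
  have h2 := (hasDerivAt_comp_add_smul h1 (v := v)).fun_div
    (hasDerivAt_comp_add_smul b.differentiableAt (v := v)) (by simpa using hp)
  have h3 : DifferentiableAt ℂ (fun q => b (η q) / b q) p := by
    simpa only [div_eq_mul_inv] using h1.fun_mul (b.differentiableAt.fun_inv hp)
  rw [(hasDerivAt_comp_add_smul h3).unique h2, fderiv_fun_comp p b.differentiableAt hη]
  simp
  field_simp

theorem HolSection.hasDirDerivAt_logConnection
    (hU : ∀ p ∈ U, ∀ i ∈ P, a i p ≠ 0)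
    (hη : AnalyticOnNhd ℂ η U) (hs : HolSection U s) (hp : p ∈ U) (v : V) :
    HasDirDerivAt (logConnection P a T η s) v p
      (SplitPair.dirDeriv (fun q => SplitPair.dirDeriv s (η q) q) v p -
        (SplitPair.logForm P a T p (fderiv ℂ η p v) (s p) -
          ∑ i ∈ P, (a i v * a i (η p) / (a i p * a i p)) • T i (s p) +
          SplitPair.logForm P a T p (η p) (SplitPair.dirDeriv s v p))) := by
  refine ((hs.dirDeriv hη).hasDirDerivAt hp v).sub ?_
  have := HasDirDerivAt.sum (P := P) fun i hi => ((hs.hasDirDerivAt hp v).map (T i)).smul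
    (analyticOnNhd_div hU hη hi p hp).differentiableAt
  simp only [SplitPair.logForm, LinearMap.sum_apply, LinearMap.smul_apply]
  convert! this using 1
  rw [← Finset.sum_sub_distrib, ← Finset.sum_add_distrib]
  refine Finset.sum_congr rfl fun i hi => ?_
  rw [fderiv_div_apply _ (hU p hp i hi) (hη p hp).differentiableAt, sub_smul]

/-- The connection `d - ∑ (daᵢ/aᵢ) Tᵢ` is flat as soon as its connection form `A` satisfies
`A ∧ A = 0`, since `A` is closed. -/
theorem isFlatConnection_logConnection
    (hT : ∀ p, (∀ i ∈ P, a i p ≠ 0) → ∀ v w, Commute (logForm P a T p v) (logForm P a T p w)) :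
    IsFlatConnection (X := X) {p : V | ∀ i ∈ P, a i p ≠ 0} (logConnection P a T) where
  isOpen_base := isOpen_hyperplaneComplement
  congr U hU _ ξ η s t hξη hst p hp := by
    rw [logConnection, logConnection, hξη hp, hst hp,
      dirDeriv_congr (Filter.eventually_of_mem (hU.mem_nhds hp) hst)]
  holSection U hUo hU ξ s hξ hs := (hs.dirDeriv hξ).sub (hs.logForm hUo hU hξ)
  add U _ _ ξ s t _ hs ht p hp := by
    have h : dirDeriv (s + t) (ξ p) p = _ :=
      ((hs.hasDirDerivAt hp (ξ p)).add (ht.hasDirDerivAt hp (ξ p))).dirDeriv_eq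
    simp only [logConnection, h, Pi.add_apply, map_add]
    abel
  linear_field U _ _ f g ξ η s _ _ _ _ hs p hp := by
    simp only [logConnection, hs.dirDeriv_add_smul hp, logForm_add_smul, LinearMap.add_apply,
      LinearMap.smul_apply]
    module
  leibniz U _ _ f ξ s hf _ hs p hp := by
    have h := ((hs.hasDirDerivAt hp (ξ p)).smul (hf p hp).differentiableAt).dirDeriv_eq
    simp only [logConnection, h, map_smul]
    module
  flat U hUo hU ξ η s hξ hη hs p hp := by
    have hcomm := LinearMap.congr_fun (hT p (hU hp) (ξ p) (η p)).eq (s p)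
    simp only [Module.End.mul_apply] at hcomm
    have hsymm : ∑ i ∈ P, (a i (ξ p) * a i (η p) / (a i p * a i p)) • T i (s p) =
        ∑ i ∈ P, (a i (η p) * a i (ξ p) / (a i p * a i p)) • T i (s p) := by
      simp only [mul_comm (a _ (ξ p))]
    have hd := hs.dirDeriv_dirDeriv_sub hp hξ hη
    -- antisymmetrization leaves `[ξ, η] s`, the contraction of `A` with `[ξ, η]`, and a commutator
    have expand : ∀ ξ η : V → V, AnalyticOnNhd ℂ η U →
        logConnection P a T ξ (logConnection P a T η s) p =
          (dirDeriv (fun q => dirDeriv s (η q) q) (ξ p) p -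
          (logForm P a T p (fderiv ℂ η p (ξ p)) (s p) -
            ∑ i ∈ P, (a i (ξ p) * a i (η p) / (a i p * a i p)) • T i (s p) +
            logForm P a T p (η p) (dirDeriv s (ξ p) p))) -
          (logForm P a T p (ξ p) (dirDeriv s (η p) p) -
            logForm P a T p (ξ p) (logForm P a T p (η p) (s p))) := fun ξ η hη => by
      rw [← map_sub, ← (hs.hasDirDerivAt_logConnection hU hη hp (ξ p)).dirDeriv_eq]
      rfl
    rw [Pi.sub_apply, expand ξ η hη, expand η ξ hξ, logConnection, ← hd,
      VectorField.lieBracket, logForm_sub, LinearMap.sub_apply, hcomm, hsymm]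
    abel

end LogConnection

/-! ### Kohno's criterion -/

section Kohno

variable {V K A : Type*} [Field K] [AddCommGroup V] [Module K V] [Ring A] [Algebra K A]

/-- The contribution of one plane, spanned by `α₀` and `β₀`, to the commutator in
`commute_sum_div_smul`. -/
theorem sum_wedge_smul_mul_eq_zero (S : Finset (Module.Dual K V))
    (T : Module.Dual K V → A) (p : V) (hp : ∀ α ∈ S, α p ≠ 0)
    (hS : ∀ α ∈ S, Commute (∑ β ∈ S, T β) (T α)) {α₀ β₀ : Module.Dual K V} (hα₀ : α₀ p ≠ 0)
    (hind : ∀ c : K, β₀ ≠ c • α₀) (hspan : ∀ α ∈ S, ∃ a b : K, a • α₀ + b • β₀ = α) (u v : V) :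
    ∑ α ∈ S, ∑ β ∈ S, ((α u * β v - β u * α v) / (α p * β p)) • (T α * T β) = 0 := by
  -- `α₀ ∧ β₀` does not vanish at `(p, y)` for a suitable `y`. On the plane, all `α ∧ β` are
  -- multiples of `α₀ ∧ β₀`, so that `(α ∧ β)(u, v) = c (α ∧ β)(p, y)` with `c` independent
  -- of `α` and `β`.
  obtain ⟨y, hy⟩ : ∃ y, α₀ p * β₀ y - β₀ p * α₀ y ≠ 0 := by
    by_contra! h
    refine hind (β₀ p / α₀ p) (LinearMap.ext fun y => ?_)
    have := h y
    simp only [LinearMap.smul_apply, smul_eq_mul]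
    field_simp
    linear_combination this
  obtain ⟨c, hc⟩ : ∃ c : K, α₀ u * β₀ v - β₀ u * α₀ v = c * (α₀ p * β₀ y - β₀ p * α₀ y) :=
    ⟨_, (div_mul_cancel₀ _ hy).symm⟩
  have key : ∀ α ∈ S, ∀ β ∈ S, ((α u * β v - β u * α v) / (α p * β p)) • (T α * T β) =
      c • (T α * ((β y / β p) • T β)) - c • (((α y / α p) • T α) * T β) := by
    intro α hα β hβ
    have h1 := hp α hα
    have h2 := hp β hβ
    have h3 : α u * β v - β u * α v = c * (α p * β y - β p * α y) := by
      obtain ⟨a, b, rfl⟩ := hspan α hα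
      obtain ⟨a', b', rfl⟩ := hspan β hβ
      simp only [LinearMap.add_apply, LinearMap.smul_apply, smul_eq_mul]
      linear_combination (a * b' - a' * b) * hc
    rw [mul_smul_comm, smul_mul_assoc, smul_smul, smul_smul, ← sub_smul, h3]
    congr 1
    field_simp
  rw [Finset.sum_congr rfl fun α hα => Finset.sum_congr rfl (key α hα)]
  simp only [Finset.sum_sub_distrib, ← Finset.smul_sum, ← Finset.sum_mul_sum]
  rw [(Commute.sum_right S _ _ fun β hβ => (hS β hβ).smul_right (β y / β p)).eq, sub_self]

open Classical in
/-- Kohno's criterion for the integrability of `d - ∑ (dα/α) T_α`: the operators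
`∑ (α(u)/α(p)) T_α` commute for all `u`, `v` if, for every subspace `W`, the sum of the `T_β` with
`β ∈ W` commutes with each of its terms. Only the planes `W` matter: the commutator is the sum over
pairs of `(α ∧ β)(u, v) / (α(p) β(p)) T_α T_β`, and linearly independent pairs are grouped according
to the plane they span. -/
theorem commute_sum_div_smul (P : Finset (Module.Dual K V)) (T : Module.Dual K V → A)
    (hT : ∀ W : Submodule K (Module.Dual K V), ∀ α ∈ P, α ∈ W →
      Commute (∑ β ∈ P with β ∈ W, T β) (T α))
    (p : V) (hp : ∀ α ∈ P, α p ≠ 0) (u v : V) :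
    Commute (∑ α ∈ P, (α u / α p) • T α) (∑ α ∈ P, (α v / α p) • T α) := by
  have hsum : ∑ x ∈ P ×ˢ P,
      ((x.1 u * x.2 v - x.2 u * x.1 v) / (x.1 p * x.2 p)) • (T x.1 * T x.2) = 0 := by
    rw [← Finset.sum_fiberwise_of_maps_to
      (g := fun x : Module.Dual K V × Module.Dual K V => Submodule.span K {x.1, x.2})
      fun x hx => Finset.mem_image_of_mem
        (fun x : Module.Dual K V × Module.Dual K V => Submodule.span K {x.1, x.2}) hx]
    refine Finset.sum_eq_zero fun W _ => ?_
    by_cases hW : ∀ x ∈ P ×ˢ P, Submodule.span K {x.1, x.2} = W →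
        x.1 u * x.2 v - x.2 u * x.1 v = 0
    · refine Finset.sum_eq_zero fun x hx => ?_
      rw [Finset.mem_filter] at hx
      rw [hW x hx.1 hx.2, zero_div, zero_smul]
    push Not at hW
    obtain ⟨⟨α₀, β₀⟩, h₀, rfl, hne⟩ := hW
    rw [Finset.mem_product] at h₀
    set W := Submodule.span K {α₀, β₀} with hWdef
    rw [← sum_wedge_smul_mul_eq_zero (P.filter (· ∈ W)) T p
      (fun α hα => hp α (Finset.mem_filter.1 hα).1)
      (fun α hα => hT W α (Finset.mem_filter.1 hα).1 (Finset.mem_filter.1 hα).2) (hp α₀ h₀.1)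
      (fun c hc => hne ?_) (fun α hα => Submodule.mem_span_pair.1 (Finset.mem_filter.1 hα).2) u v,
      ← Finset.sum_product']
    · -- the pairs in `W` which do not span `W` are linearly dependent and contribute zero
      refine Finset.sum_subset (fun x hx => ?_) fun x hx hx' => ?_
      · simp only [Finset.mem_filter, Finset.mem_product] at hx ⊢
        have h := hx.2
        refine ⟨⟨hx.1.1, ?_⟩, hx.1.2, ?_⟩ <;> rw [← h] <;> apply Submodule.subset_span <;> simp
      · simp only [Finset.mem_filter, Finset.mem_product] at hx hx'
        obtain ⟨a, b, hab⟩ := Submodule.mem_span_pair.1 hx.1.2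
        obtain ⟨a', b', hab'⟩ := Submodule.mem_span_pair.1 hx.2.2
        have hdet : a * b' - a' * b = 0 := by
          by_contra hdet
          refine hx' ⟨⟨hx.1.1, hx.2.1⟩, le_antisymm ?_ ?_⟩
          · rw [Submodule.span_le]
            rintro γ (rfl | rfl)
            exacts [hx.1.2, hx.2.2]
          · rw [hWdef, Submodule.span_le]
            rintro γ (rfl | rfl)
            · refine Submodule.mem_span_pair.2
                ⟨(a * b' - a' * b)⁻¹ * b', -((a * b' - a' * b)⁻¹ * b), ?_⟩
              rw [← hab, ← hab']
              match_scalars <;> field_simp <;> ring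
            · refine Submodule.mem_span_pair.2
                ⟨-((a * b' - a' * b)⁻¹ * a'), (a * b' - a' * b)⁻¹ * a, ?_⟩
              rw [← hab, ← hab']
              match_scalars <;> field_simp <;> ring
        have : x.1 u * x.2 v - x.2 u * x.1 v = 0 := by
          rw [← hab, ← hab']
          simp only [LinearMap.add_apply, LinearMap.smul_apply, smul_eq_mul]
          linear_combination (α₀ u * β₀ v - β₀ u * α₀ v) * hdet
        rw [this, zero_div, zero_smul]
    · simp only [hc, LinearMap.smul_apply, smul_eq_mul]
      ring
  rw [commute_iff_eq, ← sub_eq_zero, Finset.sum_mul_sum, Finset.sum_mul_sum, ← Finset.sum_product',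
    ← Finset.sum_product', ← Finset.sum_sub_distrib, ← hsum]
  refine Finset.sum_congr rfl fun x _ => ?_
  rw [smul_mul_smul_comm, smul_mul_smul_comm, ← sub_smul]
  congr 1
  rw [sub_div, div_mul_div_comm, div_mul_div_comm]
  ring

end Kohno

/-! ### Diagonalizability of a split Cartan subalgebra -/

section CartanInvolution

variable {L : Type*} [LieRing L] [LieAlgebra ℝ L] {θ : L ≃ₗ⁅ℝ⁆ L}

theorem killingForm_lie_left (x y z : L) :
    killingForm ℝ L ⁅x, y⁆ z = -killingForm ℝ L y ⁅x, z⁆ :=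
  LieModule.traceForm_apply_lie_apply' ℝ L L x y z

theorem IsCartanInvolution.isKilling (hθ : IsCartanInvolution θ) : LieAlgebra.IsKilling ℝ L where
  killingCompl_top_eq_bot := by
    rw [eq_bot_iff]
    intro x hx
    rw [LieIdeal.mem_killingCompl] at hx
    by_contra h
    have h1 := hθ.pos x (by simpa using h)
    have h2 := hx (θ x) trivial
    rw [LieModule.traceForm_comm] at h2
    rw [killingForm] at h1
    linarith

/-- The inner product `-κ(x, θ y)` attached to a Cartan involution. -/
@[reducible]
noncomputable def IsCartanInvolution.innerCore (hθ : IsCartanInvolution θ) :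
    InnerProductSpace.Core ℝ L where
  inner x y := -killingForm ℝ L x (θ y)
  conj_inner_symm x y := by
    simp only [conj_trivial]
    rw [← LieAlgebra.killingForm_of_equiv_apply θ y, hθ.involutive, LieModule.traceForm_comm]
  re_inner_nonneg x := by
    by_cases hx : x = 0
    · simp [hx]
    · exact (hθ.pos x hx).le
  add_left x y z := by simp; ring
  smul_left x y r := by simp
  definite x h := by
    by_contra hx
    exact (hθ.pos x hx).ne' h

/-- The operators `ad h` with `θ h = -h` are symmetric for the inner product `-κ(x, θ y)`, hence
diagonalizable over `ℝ`. -/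
theorem IsCartanInvolution.isTriangularizable [FiniteDimensional ℝ L] (hθ : IsCartanInvolution θ)
    {H : LieSubalgebra ℝ L} (hH : ∀ h ∈ H, θ h = -h) : LieModule.IsTriangularizable ℝ H L where
  maxGenEigenspace_eq_top h := by
    let : NormedAddCommGroup L := @InnerProductSpace.Core.toNormedAddCommGroup ℝ L _ _ _
      hθ.innerCore
    let : InnerProductSpace ℝ L := InnerProductSpace.ofCore hθ.innerCore.toCore
    have hsym : (LieModule.toEnd ℝ H L h).IsSymmetric := fun x y => by
      change -killingForm ℝ L ⁅(h : L), x⁆ (θ y) = -killingForm ℝ L x (θ ⁅(h : L), y⁆)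
      rw [LieEquiv.map_lie, hH h h.2, neg_lie, map_neg, killingForm_lie_left]
    have h1 : ⨆ μ, Module.End.eigenspace (LieModule.toEnd ℝ H L h) μ = ⊤ :=
      Submodule.orthogonal_eq_bot_iff.1 hsym.orthogonalComplement_iSup_eigenspaces_eq_bot
    rw [eq_top_iff, ← h1]
    exact iSup_mono fun μ => Module.End.eigenspace_le_maxGenEigenspace

end CartanInvolution

/-! ### Real root vectors -/

section RootSpaces

variable {L : Type*} [LieRing L] [LieAlgebra ℝ L] {θ : L ≃ₗ⁅ℝ⁆ L}
variable {H : LieSubalgebra ℝ L} {α β γ δ : Module.Dual ℂ (cartanC H)} {x y : L}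

/-- The element `1 ⊗ h` of the complexified Cartan subalgebra. -/
noncomputable def ofCartan (h : H) : cartanC H :=
  ⟨(1 : ℂ) ⊗ₜ[ℝ] (h : L), Submodule.tmul_mem_baseChange_of_mem 1 h.2⟩

theorem cartanC_eq_span : cartanC H =
    Submodule.span ℂ (H.toSubmodule.map (TensorProduct.mk ℝ ℂ L 1)) :=
  Submodule.baseChange_eq_span ..

theorem dual_ext (hαβ : ∀ h : H, α (ofCartan h) = β (ofCartan h)) : α = β := by
  refine LinearMap.ext fun ⟨u, hu⟩ => ?_
  have hu' := hu
  rw [cartanC_eq_span] at hu'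
  induction hu' using Submodule.span_induction with
  | mem u h =>
    obtain ⟨x, hx, rfl⟩ := h
    exact hαβ ⟨x, hx⟩
  | zero => exact (map_zero α).trans (map_zero β).symm
  | add u v hu' hv' h1 h2 =>
    have hu : u ∈ cartanC H := by rwa [cartanC_eq_span]
    have hv : v ∈ cartanC H := by rwa [cartanC_eq_span]
    have := congrArg₂ (· + ·) (h1 hu) (h2 hv)
    simp only [← map_add] at this
    exact this
  | smul c u hu' h1 =>
    have hu : u ∈ cartanC H := by rwa [cartanC_eq_span]
    have := congrArg (c • ·) (h1 hu)
    simp only [← map_smul] at this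
    exact this

theorem thetaC_eq_neg (hH : ∀ h ∈ H, θ h = -h) (u : cartanC H) :
    thetaC θ (u : ℂ ⊗[ℝ] L) = -(u : ℂ ⊗[ℝ] L) := by
  have hu : (u : ℂ ⊗[ℝ] L) ∈ Submodule.span ℂ (H.toSubmodule.map (TensorProduct.mk ℝ ℂ L 1)) := by
    simpa only [← cartanC_eq_span] using u.2
  refine LinearMap.eqOn_span (f := thetaC θ) (g := -LinearMap.id) ?_ hu
  rintro _ ⟨x, hx, rfl⟩
  simp only [TensorProduct.mk_apply, thetaC_tmul, hH x hx, LinearMap.neg_apply, LinearMap.id_apply,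
    TensorProduct.tmul_neg]

theorem eq_re_smul {c : ℂ} (h : (1 : ℂ) ⊗ₜ[ℝ] y = c • ((1 : ℂ) ⊗ₜ[ℝ] x)) : y = c.re • x := by
  rw [TensorProduct.smul_tmul', smul_eq_mul, mul_one] at h
  simpa using congrArg ((TensorProduct.lid ℝ L).toLinearMap ∘ₗ Complex.reLm.rTensor L) h

theorem im_smul_eq_zero {c : ℂ} (h : (1 : ℂ) ⊗ₜ[ℝ] y = c • ((1 : ℂ) ⊗ₜ[ℝ] x)) :
    c.im • x = 0 := by
  rw [TensorProduct.smul_tmul', smul_eq_mul, mul_one] at h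
  simpa using (congrArg ((TensorProduct.lid ℝ L).toLinearMap ∘ₗ Complex.imLm.rTensor L) h).symm

theorem one_tmul_ne_zero (hx : x ≠ 0) : (1 : ℂ) ⊗ₜ[ℝ] x ≠ 0 := fun h =>
  hx (by simpa using eq_re_smul (x := (0 : L)) (c := 0) (h.trans (by simp)))

theorem MemRootSpace.one_tmul_lie (hx : MemRootSpace H α ((1 : ℂ) ⊗ₜ[ℝ] x)) (h : H) :
    (1 : ℂ) ⊗ₜ[ℝ] ⁅(h : L), x⁆ = α (ofCartan h) • ((1 : ℂ) ⊗ₜ[ℝ] x) := by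
  rw [← hx (ofCartan h), ofCartan, LieAlgebra.ExtendScalars.bracket_tmul, mul_one]

theorem MemRootSpace.lie_eq (hx : MemRootSpace H α ((1 : ℂ) ⊗ₜ[ℝ] x)) (h : H) :
    ⁅(h : L), x⁆ = (α (ofCartan h)).re • x :=
  eq_re_smul (hx.one_tmul_lie h)

/-- A root with a root vector in the real form takes real values on the real Cartan subalgebra. -/
theorem MemRootSpace.im_eq_zero (hx : MemRootSpace H α ((1 : ℂ) ⊗ₜ[ℝ] x)) (h0 : x ≠ 0) (h : H) :
    (α (ofCartan h)).im = 0 :=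
  (smul_eq_zero.1 (im_smul_eq_zero (hx.one_tmul_lie h))).resolve_right h0

theorem MemRootSpace.one_tmul_lie_mem (hx : MemRootSpace H α ((1 : ℂ) ⊗ₜ[ℝ] x))
    (hy : MemRootSpace H β ((1 : ℂ) ⊗ₜ[ℝ] y)) :
    MemRootSpace H (α + β) ((1 : ℂ) ⊗ₜ[ℝ] ⁅x, y⁆) := fun h => by
  have hxy : (1 : ℂ) ⊗ₜ[ℝ] ⁅x, y⁆ = ⁅(1 : ℂ) ⊗ₜ[ℝ] x, (1 : ℂ) ⊗ₜ[ℝ] y⁆ := by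
    rw [LieAlgebra.ExtendScalars.bracket_tmul, mul_one]
  have h1 : ⁅α h • ((1 : ℂ) ⊗ₜ[ℝ] x), (1 : ℂ) ⊗ₜ[ℝ] y⁆ = α h • ⁅(1 : ℂ) ⊗ₜ[ℝ] x, (1 : ℂ) ⊗ₜ[ℝ] y⁆ :=
    smul_lie (α h) ((1 : ℂ) ⊗ₜ[ℝ] x) ((1 : ℂ) ⊗ₜ[ℝ] y)
  have h2 : ⁅(1 : ℂ) ⊗ₜ[ℝ] x, β h • ((1 : ℂ) ⊗ₜ[ℝ] y)⁆ = β h • ⁅(1 : ℂ) ⊗ₜ[ℝ] x, (1 : ℂ) ⊗ₜ[ℝ] y⁆ :=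
    lie_smul (β h) ((1 : ℂ) ⊗ₜ[ℝ] x) ((1 : ℂ) ⊗ₜ[ℝ] y)
  rw [hxy, leibniz_lie, hx h, hy h, h1, h2, ← add_smul, LinearMap.add_apply]

theorem killingForm_eq_zero_of_memRootSpace (hx : MemRootSpace H α ((1 : ℂ) ⊗ₜ[ℝ] x))
    (hy : MemRootSpace H β ((1 : ℂ) ⊗ₜ[ℝ] y)) (hαβ : α + β ≠ 0) : killingForm ℝ L x y = 0 := by
  by_cases hx0 : x = 0
  · simp [hx0]
  by_cases hy0 : y = 0
  · simp [hy0]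
  by_contra hne
  refine hαβ (dual_ext fun h => ?_)
  have := killingForm_lie_left (h : L) x y
  rw [hx.lie_eq, hy.lie_eq, map_smul, map_smul, LinearMap.smul_apply, smul_eq_mul, smul_eq_mul,
    ← sub_eq_zero, sub_neg_eq_add, ← add_mul] at this
  have := (mul_eq_zero.1 this).resolve_right hne
  refine Complex.ext ?_ ?_
  · simpa using this
  · simp [hx.im_eq_zero hx0, hy.im_eq_zero hy0]

/-- Root spaces of the real form are one-dimensional: the real parts of `α` on `H` form a weight of
the split Cartan subalgebra `H`, to which the theorem on Killing Lie algebras applies. -/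
theorem exists_smul_eq_of_memRootSpace [FiniteDimensional ℝ L] [H.IsCartanSubalgebra]
    (hθ : IsCartanInvolution θ) (hH : ∀ h ∈ H, θ h = -h) (hα : α ≠ 0)
    (hx : MemRootSpace H α ((1 : ℂ) ⊗ₜ[ℝ] x)) (hx0 : x ≠ 0)
    (hy : MemRootSpace H α ((1 : ℂ) ⊗ₜ[ℝ] y)) : ∃ c : ℝ, c • x = y := by
  have := hθ.isKilling
  have := hθ.isTriangularizable hH
  let χ : H → ℝ := fun h => (α (ofCartan h)).re
  have hx' : x ∈ LieAlgebra.rootSpace H χ :=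
    LieModule.weightSpace_le_genWeightSpace L χ ((LieModule.mem_weightSpace χ x).2 hx.lie_eq)
  have hy' : y ∈ LieAlgebra.rootSpace H χ :=
    LieModule.weightSpace_le_genWeightSpace L χ ((LieModule.mem_weightSpace χ y).2 hy.lie_eq)
  let w : LieModule.Weight ℝ H L := ⟨χ, fun h => hx0 (by
    rwa [LieAlgebra.rootSpace, h, LieSubmodule.mem_bot] at hx')⟩
  have hw : w.IsNonZero := fun h => hα <| dual_ext fun a =>
    Complex.ext (congrFun h a) (by simpa using hx.im_eq_zero hx0 a)
  obtain ⟨c, hc⟩ := (finrank_eq_one_iff_of_nonzero' (⟨x, hx'⟩ : LieAlgebra.rootSpace H χ)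
    (fun h => hx0 (congrArg Subtype.val h))).1
    (LieAlgebra.IsKilling.finrank_rootSpace_eq_one w hw) ⟨y, hy'⟩
  exact ⟨c, congrArg Subtype.val hc⟩

end RootSpaces

/-! ### Brackets of the vectors `E_{-α} - E_α` -/

section BoundaryVectors

variable {L : Type*} [LieRing L] [LieAlgebra ℝ L] {θ : L ≃ₗ⁅ℝ⁆ L}
variable {H : LieSubalgebra ℝ L} {E : Module.Dual ℂ (cartanC H) → L}
variable {P : Finset (Module.Dual ℂ (cartanC H))} {α β γ δ : Module.Dual ℂ (cartanC H)}

/-- The vector `E_{-α} - E_α` of the real form, of which `B_α` is the complexification. -/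
noncomputable def boundaryVec (E : Module.Dual ℂ (cartanC H) → L)
    (α : Module.Dual ℂ (cartanC H)) : L :=
  E (-α) - E α

theorem boundaryVec_neg : boundaryVec E (-α) = -boundaryVec E α := by
  rw [boundaryVec, boundaryVec, neg_neg, neg_sub]

theorem IsRootVectorSystem.ne_zero (hE : IsRootVectorSystem θ H E) (hα : IsRoot H α) :
    E α ≠ 0 := fun h => by
  have := hE.killing_eq_one α hα
  simp [h] at this

theorem IsRootVectorSystem.isRoot_neg (hE : IsRootVectorSystem θ H E) (hH : ∀ h ∈ H, θ h = -h)
    (hα : IsRoot H α) : IsRoot H (-α) := by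
  have hne : E (-α) ≠ 0 := fun h => by
    have := hE.killing_eq_one α hα
    simp [h] at this
  refine ⟨neg_ne_zero.2 hα.1, _, one_tmul_ne_zero hne, fun u => ?_⟩
  have h1 : (1 : ℂ) ⊗ₜ[ℝ] E (-α) = -thetaC θ ((1 : ℂ) ⊗ₜ[ℝ] E α) := by
    rw [thetaC_tmul, hE.theta_eq α hα, TensorProduct.tmul_neg, neg_neg]
  have h3 : ⁅(u : ℂ ⊗[ℝ] L), (1 : ℂ) ⊗ₜ[ℝ] E (-α)⁆ =
      thetaC θ ⁅(u : ℂ ⊗[ℝ] L), (1 : ℂ) ⊗ₜ[ℝ] E α⁆ := by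
    rw [thetaC_lie, h1, thetaC_eq_neg hH u]
    exact (lie_neg (u : ℂ ⊗[ℝ] L) (thetaC θ ((1 : ℂ) ⊗ₜ[ℝ] E α))).trans (neg_lie _ _).symm
  rw [h3, hE.mem_rootSpace α hα u, map_smul, h1, LinearMap.neg_apply, smul_neg, neg_smul, neg_neg]

/-- Only the component of `[E_γ, E_δ] + θ [E_γ, E_δ]` along `E_{-γ-δ} - E_{γ+δ}` is nonzero. -/
theorem IsRootVectorSystem.lie_add_lie_neg_mem [FiniteDimensional ℝ L] [H.IsCartanSubalgebra]
    (hE : IsRootVectorSystem θ H E) (hθ : IsCartanInvolution θ) (hH : ∀ h ∈ H, θ h = -h)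
    (hγ : IsRoot H γ) (hδ : IsRoot H δ) (hne : γ + δ ≠ 0) {N : Submodule ℝ L}
    (hN : IsRoot H (γ + δ) → boundaryVec E (γ + δ) ∈ N) :
    ⁅E γ, E δ⁆ + ⁅E (-γ), E (-δ)⁆ ∈ N := by
  have hneg : ⁅E (-γ), E (-δ)⁆ = θ ⁅E γ, E δ⁆ := by
    rw [LieEquiv.map_lie, hE.theta_eq γ hγ, hE.theta_eq δ hδ, neg_lie, lie_neg, neg_neg]
  rw [hneg]
  by_cases h0 : ⁅E γ, E δ⁆ = 0
  · rw [h0, map_zero, add_zero]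
    exact N.zero_mem
  have hmem := (hE.mem_rootSpace γ hγ).one_tmul_lie_mem (hE.mem_rootSpace δ hδ)
  have hroot : IsRoot H (γ + δ) := ⟨hne, _, one_tmul_ne_zero h0, hmem⟩
  obtain ⟨c, hc⟩ := exists_smul_eq_of_memRootSpace hθ hH hne (hE.mem_rootSpace _ hroot)
    (hE.ne_zero hroot) hmem
  have : ⁅E γ, E δ⁆ + θ ⁅E γ, E δ⁆ = -c • boundaryVec E (γ + δ) := by
    rw [← hc, map_smul, hE.theta_eq _ hroot, boundaryVec]
    module
  rw [this]
  exact N.smul_mem _ (hN hroot)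

theorem IsPositiveSystem.neg_notMem (hP : IsPositiveSystem H P) (hα : α ∈ P) : -α ∉ P := by
  rcases hP.exactly_one α (hP.isRoot α hα) with h | h
  exacts [h.2, absurd hα h.2]

/-- The vectors `E_{-α} - E_α` with `α ∈ P` in a subspace `W` span a Lie subalgebra. -/
theorem lie_boundaryVec_mem_span [FiniteDimensional ℝ L] [H.IsCartanSubalgebra]
    (hE : IsRootVectorSystem θ H E) (hθ : IsCartanInvolution θ) (hH : ∀ h ∈ H, θ h = -h)
    (hP : IsPositiveSystem H P) (W : Submodule ℂ (Module.Dual ℂ (cartanC H)))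
    (hγ : γ ∈ P) (hγW : γ ∈ W) (hδ : δ ∈ P) (hδW : δ ∈ W) :
    ⁅boundaryVec E γ, boundaryVec E δ⁆ ∈
      Submodule.span ℝ (boundaryVec E '' {ε | ε ∈ P ∧ ε ∈ W}) := by
  set N := Submodule.span ℝ (boundaryVec E '' {ε | ε ∈ P ∧ ε ∈ W})
  have hN : ∀ ε, ε ∈ W → IsRoot H ε → boundaryVec E ε ∈ N := by
    intro ε hW hε
    rcases hP.exactly_one ε hε with h | h
    · exact Submodule.subset_span ⟨ε, ⟨h.1, hW⟩, rfl⟩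
    · rw [← neg_neg ε, boundaryVec_neg]
      exact N.neg_mem (Submodule.subset_span ⟨-ε, ⟨h.1, W.neg_mem hW⟩, rfl⟩)
  rcases eq_or_ne γ δ with rfl | hne
  · rw [lie_self]
    exact N.zero_mem
  have h1 := hE.lie_add_lie_neg_mem hθ hH (hP.isRoot γ hγ) (hP.isRoot δ hδ)
    (fun h => hP.neg_notMem hγ (by rwa [neg_eq_of_add_eq_zero_right h]))
    (hN _ (W.add_mem hγW hδW))
  have h2 := hE.lie_add_lie_neg_mem hθ hH (hE.isRoot_neg hH (hP.isRoot γ hγ)) (hP.isRoot δ hδ)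
    (fun h => hne (neg_add_eq_zero.1 h)) (hN _ (W.add_mem (W.neg_mem hγW) hδW))
  rw [neg_neg] at h2
  have : ⁅boundaryVec E γ, boundaryVec E δ⁆ =
      (⁅E γ, E δ⁆ + ⁅E (-γ), E (-δ)⁆) - (⁅E (-γ), E δ⁆ + ⁅E γ, E (-δ)⁆) := by
    simp only [boundaryVec, sub_lie, lie_sub]
    abel
  rw [this]
  exact N.sub_mem h1 h2

open Classical in
theorem killingForm_boundaryVec (hE : IsRootVectorSystem θ H E) (hH : ∀ h ∈ H, θ h = -h)
    (hP : IsPositiveSystem H P) (hα : α ∈ P) (hβ : β ∈ P) :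
    killingForm ℝ L (boundaryVec E α) (boundaryVec E β) = if α = β then -2 else 0 := by
  have hα' := hP.isRoot α hα
  have hβ' := hP.isRoot β hβ
  have mα := hE.mem_rootSpace _ hα'
  have mβ := hE.mem_rootSpace _ hβ'
  have mα' := hE.mem_rootSpace _ (hE.isRoot_neg hH hα')
  have mβ' := hE.mem_rootSpace _ (hE.isRoot_neg hH hβ')
  have hadd : α + β ≠ 0 := fun h => hP.neg_notMem hα (by rwa [neg_eq_of_add_eq_zero_right h])
  have h1 := killingForm_eq_zero_of_memRootSpace mα mβ hadd
  have h2 := killingForm_eq_zero_of_memRootSpace mα' mβ' fun h => hadd (by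
    rw [← neg_eq_zero, neg_add, h])
  simp only [boundaryVec, map_sub, LinearMap.sub_apply, h1, h2]
  split_ifs with h
  · subst h
    have h3 := hE.killing_eq_one α hα'
    have h4 := hE.killing_eq_one _ (hE.isRoot_neg hH hα')
    rw [neg_neg] at h4
    rw [h3, h4]
    norm_num
  · rw [killingForm_eq_zero_of_memRootSpace mα' mβ fun h' => h (neg_add_eq_zero.1 h'),
      killingForm_eq_zero_of_memRootSpace mα mβ' fun h' => h (add_neg_eq_zero.1 h')]
    norm_num

open Classical in
/-- The vectors `E_{-α} - E_α`, `α ∈ P`, are orthogonal of square length `-2` for the Killing form;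
this is the resulting expansion of an element of the span of some of them. -/
theorem eq_sum_killingForm_smul (hE : IsRootVectorSystem θ H E) (hH : ∀ h ∈ H, θ h = -h)
    (hP : IsPositiveSystem H P) (W : Submodule ℂ (Module.Dual ℂ (cartanC H))) {x : L}
    (hx : x ∈ Submodule.span ℝ (boundaryVec E '' {ε | ε ∈ P ∧ ε ∈ W})) :
    x = ∑ ε ∈ P with ε ∈ W, (-(killingForm ℝ L x (boundaryVec E ε)) / 2) • boundaryVec E ε := by
  induction hx using Submodule.span_induction with
  | mem x h =>
    obtain ⟨α, hα, rfl⟩ := h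
    rw [Finset.sum_eq_single_of_mem α (Finset.mem_filter.2 hα) fun β hβ hne => by
      rw [killingForm_boundaryVec hE hH hP hα.1 (Finset.mem_filter.1 hβ).1, if_neg hne.symm]
      simp, killingForm_boundaryVec hE hH hP hα.1 hα.1]
    simp
  | zero => simp
  | add x y _ _ hx hy =>
    nth_rw 1 [hx, hy]
    rw [← Finset.sum_add_distrib]
    refine Finset.sum_congr rfl fun ε _ => ?_
    rw [← add_smul, map_add, LinearMap.add_apply]
    ring_nf
  | smul c x _ hx =>
    nth_rw 1 [hx]
    rw [Finset.smul_sum]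
    refine Finset.sum_congr rfl fun ε _ => ?_
    rw [smul_smul, map_smul, LinearMap.smul_apply, smul_eq_mul]
    ring_nf

end BoundaryVectors

/-! ### The partial Casimir operators of `𝔨` -/

section Casimir

/-- `∑ bᵢ²` commutes with `g` if bracketing with `g` preserves the span of the `bᵢ` and has an
antisymmetric matrix there. -/
theorem commute_sum_mul_self {ι K A : Type*} [CommRing K] [Ring A] [Algebra K A] (S : Finset ι)
    (b : ι → A) (g : A) (c : ι → ι → K) (hc : ∀ i j, c j i = -c i j)
    (hb : ∀ i ∈ S, g * b i - b i * g = ∑ j ∈ S, c i j • b j) :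
    Commute (∑ i ∈ S, b i * b i) g := by
  have h : ∀ i ∈ S, g * (b i * b i) - b i * b i * g =
      ∑ j ∈ S, c i j • (b j * b i) + ∑ j ∈ S, c i j • (b i * b j) := fun i hi => by
    have h1 : ∑ j ∈ S, c i j • (b j * b i) = (g * b i - b i * g) * b i := by
      rw [hb i hi, Finset.sum_mul]
      simp only [smul_mul_assoc]
    have h2 : ∑ j ∈ S, c i j • (b i * b j) = b i * (g * b i - b i * g) := by
      rw [hb i hi, Finset.mul_sum]
      simp only [mul_smul_comm]
    rw [h1, h2]
    noncomm_ring
  refine Eq.symm ?_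
  rw [← sub_eq_zero, Finset.mul_sum, Finset.sum_mul, ← Finset.sum_sub_distrib,
    Finset.sum_congr rfl h, Finset.sum_add_distrib]
  nth_rw 2 [Finset.sum_comm]
  rw [← Finset.sum_add_distrib]
  refine Finset.sum_eq_zero fun i _ => ?_
  rw [← Finset.sum_add_distrib]
  refine Finset.sum_eq_zero fun j _ => ?_
  rw [hc i j, neg_smul, add_neg_cancel]

variable {L : Type*} [LieRing L] [LieAlgebra ℝ L] {θ : L ≃ₗ⁅ℝ⁆ L}
variable {H : LieSubalgebra ℝ L} {E : Module.Dual ℂ (cartanC H) → L}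
variable {P : Finset (Module.Dual ℂ (cartanC H))} {α β γ δ : Module.Dual ℂ (cartanC H)}
variable {X : Type*} [AddCommGroup X] [Module ℂ X]

theorem coe_boundaryGen (hE : IsRootVectorSystem θ H E) (hH : ∀ h ∈ H, θ h = -h)
    (hθ : IsCartanInvolution θ) (hα : IsRoot H α) :
    (boundaryGen hθ E α : ℂ ⊗[ℝ] L) = (1 : ℂ) ⊗ₜ[ℝ] boundaryVec E α := by
  change (1 : ℂ) ⊗ₜ[ℝ] (E (-α) + θ (E (-α))) = _
  rw [hE.theta_eq _ (hE.isRoot_neg hH hα), neg_neg, ← sub_eq_add_neg, boundaryVec]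

open Classical in
/-- For every subspace `W`, the operator `∑ B_β²` over the positive roots in `W` is a Casimir
operator of the subalgebra of `𝔨` spanned by these `B_β`. -/
theorem commute_sum_boundaryGen_sq [FiniteDimensional ℝ L] [H.IsCartanSubalgebra]
    [LieRingModule (fixedPoints θ) X] [LieModule ℂ (fixedPoints θ) X]
    (hE : IsRootVectorSystem θ H E) (hθ : IsCartanInvolution θ) (hH : ∀ h ∈ H, θ h = -h)
    (hP : IsPositiveSystem H P) (W : Submodule ℂ (Module.Dual ℂ (cartanC H)))
    (hγ : γ ∈ P) (hγW : γ ∈ W) :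
    Commute (∑ α ∈ P with α ∈ W, LieModule.toEnd ℂ (fixedPoints θ) X (boundaryGen hθ E α) *
        LieModule.toEnd ℂ (fixedPoints θ) X (boundaryGen hθ E α))
      (LieModule.toEnd ℂ (fixedPoints θ) X (boundaryGen hθ E γ)) := by
  let c (α β : Module.Dual ℂ (cartanC H)) : ℝ :=
    -(killingForm ℝ L ⁅boundaryVec E γ, boundaryVec E α⁆ (boundaryVec E β)) / 2
  have hc : ∀ α β, c β α = -c α β := fun α β => by
    simp only [c]
    rw [killingForm_lie_left, LieModule.traceForm_comm]
    ring
  refine commute_sum_mul_self _ _ _ (fun α β => (c α β : ℂ))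
    (fun α β => by rw [hc, Complex.ofReal_neg]) fun α hα => ?_
  rw [Finset.mem_filter] at hα
  have h1 := eq_sum_killingForm_smul hE hH hP W
    (lie_boundaryVec_mem_span hE hθ hH hP W hγ hγW hα.1 hα.2)
  have h2 : ⁅boundaryGen hθ E γ, boundaryGen hθ E α⁆ =
      ∑ β ∈ P with β ∈ W, (c α β : ℂ) • boundaryGen hθ E β := by
    refine Subtype.ext ?_
    rw [LieSubalgebra.coe_bracket, coe_boundaryGen hE hH hθ (hP.isRoot γ hγ),
      coe_boundaryGen hE hH hθ (hP.isRoot α hα.1), LieAlgebra.ExtendScalars.bracket_tmul, mul_one,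
      h1, TensorProduct.tmul_sum, AddSubmonoidClass.coe_finsetSum]
    refine Finset.sum_congr rfl fun β hβ => ?_
    rw [SetLike.val_smul, coe_boundaryGen hE hH hθ (hP.isRoot β (Finset.mem_filter.1 hβ).1),
      TensorProduct.tmul_smul, Complex.coe_smul]
    rfl
  simp only [← map_smul, ← map_sum, ← h2]
  refine LinearMap.ext fun x => ?_
  simp only [LinearMap.sub_apply, Module.End.mul_apply, LieModule.toEnd_apply_apply, lie_lie]

end Casimir

/-! ### The boundary Casimir connection as a logarithmic connection -/

section BoundaryCasimir

variable {L : Type*} [LieRing L] [LieAlgebra ℝ L] {θ : L ≃ₗ⁅ℝ⁆ L}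
variable {H : LieSubalgebra ℝ L} {E : Module.Dual ℂ (cartanC H) → L}
variable {P : Finset (Module.Dual ℂ (cartanC H))} {n : ℕ} (z : cartanC H ≃ₗ[ℂ] (Fin n → ℂ))
variable {X : Type*} [AddCommGroup X] [Module ℂ X]
variable [LieRingModule (fixedPoints θ) X] [LieModule ℂ (fixedPoints θ) X]

/-- The linear form `α` in the linear coordinates `z`. -/
noncomputable def coordForm (α : Module.Dual ℂ (cartanC H)) : (Fin n → ℂ) →L[ℂ] ℂ :=
  (α ∘ₗ z.symm.toLinearMap).toContinuousLinearMap

theorem coordForm_apply (α : Module.Dual ℂ (cartanC H)) (p : Fin n → ℂ) :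
    coordForm z α p = α (z.symm p) := rfl

variable (X) in
/-- The action of `B_α²` on `X`. -/
noncomputable def boundarySq (hθ : IsCartanInvolution θ) (E : Module.Dual ℂ (cartanC H) → L)
    (α : Module.Dual ℂ (cartanC H)) : Module.End ℂ X :=
  LieModule.toEnd ℂ (fixedPoints θ) X (boundaryGen hθ E α) *
    LieModule.toEnd ℂ (fixedPoints θ) X (boundaryGen hθ E α)

theorem boundaryCasimir_eq (hθ : IsCartanInvolution θ) {κ : ℂ} (hκ : κ ≠ 0)
    (ξ : (Fin n → ℂ) → (Fin n → ℂ)) (s : (Fin n → ℂ) → X) :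
    boundaryCasimir hθ E P z κ ξ s = fun p =>
      κ • logConnection P (coordForm z) (fun α => κ⁻¹ • boundarySq X hθ E α) ξ s p := by
  funext p
  simp only [boundaryCasimir, logConnection, logForm, LinearMap.sum_apply, LinearMap.smul_apply,
    coordForm_apply, smul_sub, Finset.smul_sum]
  congr 1
  refine Finset.sum_congr rfl fun α _ => ?_
  rw [smul_comm κ, smul_smul κ, mul_inv_cancel₀ hκ, one_smul]
  rfl

theorem isFlatConnection_boundaryCasimir [FiniteDimensional ℝ L] [H.IsCartanSubalgebra]
    (hE : IsRootVectorSystem θ H E) (hθ : IsCartanInvolution θ) (hH : ∀ h ∈ H, θ h = -h)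
    (hP : IsPositiveSystem H P) (κ : ℂ) :
    IsFlatConnection (X := X) (hReg z P)
      (logConnection P (coordForm z) fun α => κ⁻¹ • boundarySq X hθ E α) := by
  classical
  refine isFlatConnection_logConnection (P := P) (a := coordForm z)
    (T := fun α => κ⁻¹ • boundarySq X hθ E α) fun p hp v w => ?_
  refine commute_sum_div_smul P (fun α => κ⁻¹ • boundarySq X hθ E α) (fun W α hα hαW => ?_)
    (z.symm p) hp (z.symm v) (z.symm w)
  have h := commute_sum_boundaryGen_sq (X := X) hE hθ hH hP W hα hαW
  rw [← Finset.smul_sum]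
  exact ((h.mul_right h).smul_left _).smul_right _

end BoundaryCasimir
end SplitPair

theorem theorem7p4
    {L : Type*} [LieRing L] [LieAlgebra ℝ L] [FiniteDimensional ℝ L] [LieAlgebra.IsSimple ℝ L]
    (θ : L ≃ₗ⁅ℝ⁆ L) (hθ : SplitPair.IsCartanInvolution θ)
    (H : LieSubalgebra ℝ L) [H.IsCartanSubalgebra] (hH : ∀ h ∈ H, θ h = -h)
    (E : Module.Dual ℂ (SplitPair.cartanC H) → L) (hE : SplitPair.IsRootVectorSystem θ H E)
    (P : Finset (Module.Dual ℂ (SplitPair.cartanC H))) (hP : SplitPair.IsPositiveSystem H P)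
    {n : ℕ} (z : SplitPair.cartanC H ≃ₗ[ℂ] (Fin n → ℂ))
    (X : Type*) [AddCommGroup X] [Module ℂ X]
    [LieRingModule (SplitPair.fixedPoints θ) X] [LieModule ℂ (SplitPair.fixedPoints θ) X]
    (κ : ℂ) (hκ : κ ≠ 0) :
    SplitPair.IsFlatConnection (X := X) (SplitPair.hReg z P)
      (fun ξ s p => κ⁻¹ • SplitPair.boundaryCasimir hθ E P z κ ξ s p) ∧
    ∀ U : Set (Fin n → ℂ), IsOpen U → U ⊆ SplitPair.hReg z P →
      ∀ s : (Fin n → ℂ) → X, SplitPair.HolSection U s → ∀ i j : Fin n, ∀ p ∈ U,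
        SplitPair.boundaryCasimir hθ E P z κ (fun _ => Pi.single i 1)
            (SplitPair.boundaryCasimir hθ E P z κ (fun _ => Pi.single j 1) s) p =
          SplitPair.boundaryCasimir hθ E P z κ (fun _ => Pi.single j 1)
            (SplitPair.boundaryCasimir hθ E P z κ (fun _ => Pi.single i 1) s) p := by
  have hflat := SplitPair.isFlatConnection_boundaryCasimir (X := X) z hE hθ hH hP κ
  refine ⟨?_, fun U hUo hU s hs i j p hp => ?_⟩
  · convert! hflat using 4 with ξ s p
    rw [SplitPair.boundaryCasimir_eq z hθ hκ, smul_smul, inv_mul_cancel₀ hκ, one_smul]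
  · simp only [SplitPair.boundaryCasimir_eq z hθ hκ]
    -- constants may be pulled out of `∇`, and constant vector fields commute
    have hconst : ∀ v : Fin n → ℂ, AnalyticOnNhd ℂ (fun _ : Fin n → ℂ => v) U :=
      fun v => analyticOnNhd_const
    have hpull := fun v w => hflat.leibniz U hUo hU (fun _ => κ) (fun _ => v) _
      analyticOnNhd_const (hconst v) (hflat.holSection U hUo hU (fun _ => w) s (hconst w) hs) hp
    have hcomm := hflat.flat U hUo hU _ _ s (hconst (Pi.single i 1)) (hconst (Pi.single j 1)) hs hp
    have hzero : VectorField.lieBracket ℂ (fun _ : Fin n → ℂ => (Pi.single i 1 : Fin n → ℂ))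
        (fun _ => Pi.single j 1) = fun _ => 0 := by
      funext q
      simp [VectorField.lieBracket]
    have hnull := hflat.linear_field U hUo hU (fun _ => 0) (fun _ => 0) (fun _ => 0) (fun _ => 0) s
      analyticOnNhd_const analyticOnNhd_const (hconst 0) (hconst 0) hs hp
    simp only [smul_zero, add_zero, zero_smul] at hnull
    rw [hzero, hnull, Pi.sub_apply, sub_eq_zero] at hcomm
    rw [hpull, hpull]
    beta_reduce
    rw [hcomm, fderiv_const_apply, zero_apply, zero_apply, zero_smul, zero_smul]
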